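/- Consider Feynman graphs with one complex rank-4 tensor field $\varphi_{1234},\bar\varphi_{1234}$. The allowed vertices are the following. (a) The $\varphi^6$ vertices are the trace invariants $\varphi_{1,2,3,4}\bar\varphi_{1',2,3,4}\varphi_{1',2',3',4'}\bar\varphi_{1'',2',3',4'}\varphi_{1'',2'',3'',4''}\bar\varphi_{1,2'',3'',4''}$ and $\varphi_{1,2,3,4}\bar\varphi_{1',2',3',4}\varphi_{1',2',3',4'}\bar\varphi_{1'',2,3,4'}\varphi_{1'',2'',3'',4''}\bar\varphi_{1,2'',3'',4''}$, up to permutations of the four colors. (b) The $\varphi^4$ vertices are the trace invariants $\varphi_{1,2,3,4}\bar\varphi_{1',2,3,4}\varphi_{1',2',3',4'}\bar\varphi_{1,2',3',4'}$, up to permutations of the four colors; let $V_4$ be their number. (c) There are mass vertices $\bar\varphi\varphi$ (number $V_2$) and wave-function vertices $\bar\varphi(-\Delta)\varphi$ (number $V_2'$). (d) There are anomalous vertices $(\bar\varphi\varphi)^2$, each of which is cut into its two disconnected two-point factors $\bar\varphi\varphi$; let $V_2''$ be the number of these factors. Each line joins a field $\varphi$ to a field $\bar\varphi$ and carries four strands,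 colored $1,\dots,4$. The fields left unjoined are the $N_{\rm ext}$ external legs. Let $\mathcal G$ be a finite graph of this kind which is connected after the cutting in (d). Let $L$ be its number of (internal) lines and $F$ its number of internal (closed) faces, i.e. closed circuits of strands of one color. The colored extension $\mathcal G_{\rm color}$ has the fields of $\mathcal G$ as its (5-valent) vertices. Its lines of color $0$ are the lines of $\mathcal G$, its external legs are those of $\mathcal G$, and its lines of color $a\in\{1,2,3,4\}$ are the strands of color $a$ inside the vertices of $\mathcal G$. A jacket $J$ of $\mathcal G_{\rm color}$ is the ribbon graph with the same vertices, lines and legs that is defined by a cyclic order of the colors $0,1,2,3,4$ up to orientation. The pinched jacket $\widetilde J$ is obtained from $J$ by closing every external leg, i.e. by joining its two strands. The boundary graph $\partial\mathcal G$ has the external legs of $\mathcal G$ as vertices and, as lines of color $a$, the open faces of color $a$ of $\mathcal G$. Let $C_{\partial\mathcal G}$ be its number of connected components. Its jackets $J_\partial$ are the ribbon graphs defined by the cyclic orders of the colors $1,2,3,4$ up to orientation. The genus $g$ of a closed ribbon graph with $C$ components, $V$ vertices, $L$ lines and $F$ faces is given by $2C-2g=V-L+F$; it is the sum of the genera of the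 components. Theorem. The divergence degree $\omega_d(\mathcal G)=-2L+F+2V_2'$ is an integer, and $$\omega_d(\mathcal G)=-\frac13\Big[\sum_J g_{\widetilde J}-\sum_{J_\partial}g_{J_\partial}\Big]-(C_{\partial\mathcal G}-1)-V_4-2(V_2+V_2'')-\frac12\,(N_{\rm ext}-6),$$ where the first sum runs over the 12 jackets of $\mathcal G_{\rm color}$ and the second one over the 3 jackets of $\partial\mathcal G$. -/

import Mathlib

/-! ### Orbits of permutations -/

/-- The number of orbits of the group generated by a set `S` of permutations of `X`. For `S = {σ}`
this is the number of cycles of `σ`, fixed points included. -/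
noncomputable def numOrbits {X : Type*} (S : Set (Equiv.Perm X)) : ℕ :=
  Nat.card (MulAction.orbitRel.Quotient (Subgroup.closure S) X)

/-! ### Orientable ribbon graphs, possibly with external legs -/

/-- An orientable ribbon graph (combinatorial map) with external legs. Its half-edges form `H`; the
cycles of `rot` are the vertices with their cyclic order; `link` exchanges the two halves of every
line; the fixed points of `link` are the external legs. -/
structure RibbonGraph (H : Type*) where
  rot : Equiv.Perm H
  link : Equiv.Perm H
  link_link : ∀ h, link (link h) = h

namespace RibbonGraph

variable {H : Type*} (R : RibbonGraph H)

noncomputable def numVertices : ℕ := numOrbits {R.rot}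

/-- The number of (internal) lines: external legs are not counted. -/
noncomputable def numLines : ℕ := Nat.card {h : H // R.link h ≠ h} / 2

/-- The number of faces of the pinched (closed) ribbon graph. A face is followed along
`h ↦ rot (link h)`; at an external leg (`link h = h`) this walk turns around the end of the leg,
which means that the two strands of the leg have been joined to each other. For a ribbon graph
without legs these are just its faces. -/
noncomputable def numPinchedFaces : ℕ := numOrbits {R.rot * R.link}

noncomputable def numComponents : ℕ := numOrbits {R.rot, R.link}

/-- The Euler characteristic of the closed surface defined by the pinched ribbon graph. -/
noncomputable def eulerChar : ℤ := R.numVertices - R.numLines + R.numPinchedFaces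

/-- The genus of the pinched ribbon graph, defined by `2 C - 2 g = V - L + F`; it is the sum of
the genera of the connected components. -/
noncomputable def genus : ℚ := (2 * (R.numComponents : ℚ) - (R.eulerChar : ℚ)) / 2

end RibbonGraph

/-! ### Colored graphs, possibly with external legs -/

/-- A bipartite `n`-valent graph with vertex set `X` whose lines are properly colored by `Fin n`:
`edge c x` is the neighbour of `x` along the line of color `c`, and `edge c x = x` means that the
half-line of color `c` at `x` is an external leg. -/
structure ColoredGraph (n : ℕ) (X : Type*) where
  white : X → Bool
  edge : Fin n → Equiv.Perm X
  edge_edge : ∀ c x, edge c (edge c x) = x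
  bipartite : ∀ c x, edge c x ≠ x → white (edge c x) = !white x

/-- The jackets of an `n`-colored graph: the cyclic orders `τ` of the `n` colors up to orientation.
Each class `{τ, τ⁻¹}` is represented by the orientation with `τ 0 < τ⁻¹ 0`. -/
def jacketCycles (n : ℕ) [NeZero n] : Finset (Equiv.Perm (Fin n)) :=
  Finset.univ.filter fun τ => τ.cycleType = {n} ∧ τ 0 < τ⁻¹ 0

theorem card_jacketCycles_five : (jacketCycles 5).card = 12 := by decide +kernel

theorem card_jacketCycles_four : (jacketCycles 4).card = 3 := by decide +kernel

namespace ColoredGraph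

variable {n : ℕ} {X : Type*}

noncomputable def numComponents (B : ColoredGraph n X) : ℕ := numOrbits (Set.range B.edge)

/-- The jacket of `B` for the cyclic order `τ` of the colors: the ribbon graph with the same
vertices, lines and legs as `B`, in which the half-lines around each white vertex are ordered by
`τ` and those around each black vertex by `τ⁻¹`. Its faces are thus the faces of `B` whose two
colors are adjacent in the cycle `τ`. -/
def jacket (B : ColoredGraph n X) (τ : Equiv.Perm (Fin n)) : RibbonGraph (X × Fin n) where
  rot := Equiv.prodShear (Equiv.refl X) fun x => if B.white x then τ else τ⁻¹
  link := Function.Involutive.toPerm (fun p => (B.edge p.2 p.1, p.2))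
    fun p => Prod.ext (B.edge_edge p.2 p.1) rfl
  link_link := fun p => Prod.ext (B.edge_edge p.2 p.1) rfl

/-- One step along a face of colors `0` and `c`: cross the line of color `0` (stay in place if it
is an external leg), then the line of color `c`. -/
def faceStep (B : ColoredGraph (n + 1) X) (c : Fin (n + 1)) : Equiv.Perm X := B.edge c * B.edge 0

/-- The vertices that carry an external leg of color `0`. -/
abbrev Leg (B : ColoredGraph (n + 1) X) : Type _ := {x : X // B.edge 0 x = x}

variable (B : ColoredGraph (n + 1) X)

theorem exists_return [Finite X] (c : Fin (n + 1)) (x : B.Leg) :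
    ∃ k, 0 < k ∧ B.edge 0 ((B.faceStep c ^ k) x.1) = (B.faceStep c ^ k) x.1 :=
  ⟨orderOf (B.faceStep c), orderOf_pos _, by rw [pow_orderOf_eq_one]; exact x.2⟩

open Classical in
/-- The number of lines of color `c` on the open face of colors `0` and `c` that starts at `x`. -/
noncomputable def returnTime [Finite X] (c : Fin (n + 1)) (x : B.Leg) : ℕ :=
  Nat.find (B.exists_return c x)

open Classical in
/-- The open face of colors `0` and `c` that starts at the leg `x` ends at the leg
`B.otherEnd c x`. -/
noncomputable def otherEnd [Finite X] (c : Fin (n + 1)) (x : B.Leg) : B.Leg :=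
  ⟨(B.faceStep c ^ B.returnTime c x) x.1, (Nat.find_spec (B.exists_return c x)).2⟩

theorem edge_zero_pow (c : Fin (n + 1)) (x : B.Leg) (k : ℕ) :
    (B.faceStep c ^ k) (B.edge 0 ((B.faceStep c ^ k) x.1)) = x.1 := by
  induction k with
  | zero => simpa using x.2
  | succ k ih =>
    have h : B.faceStep c (B.edge 0 (B.faceStep c ((B.faceStep c ^ k) x.1)))
        = B.edge 0 ((B.faceStep c ^ k) x.1) := by
      simp only [faceStep, Equiv.Perm.mul_apply, B.edge_edge]
    have h1 : (B.faceStep c ^ (k + 1)) x.1 = B.faceStep c ((B.faceStep c ^ k) x.1) := by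
      rw [pow_succ', Equiv.Perm.mul_apply]
    rw [h1, pow_succ, Equiv.Perm.mul_apply, h, ih]

open Classical in
theorem otherEnd_otherEnd [Finite X] (c : Fin (n + 1)) (x : B.Leg) :
    B.otherEnd c (B.otherEnd c x) = x := by
  obtain ⟨hpos, hleg⟩ := Nat.find_spec (B.exists_return c x)
  have hback : (B.faceStep c ^ B.returnTime c x) (B.otherEnd c x).1 = x.1 := by
    have h := B.edge_zero_pow c x (B.returnTime c x)
    rwa [show B.edge 0 ((B.faceStep c ^ B.returnTime c x) x.1)
      = (B.faceStep c ^ B.returnTime c x) x.1 from hleg] at h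
  have htime : B.returnTime c (B.otherEnd c x) = B.returnTime c x := by
    refine (Nat.find_eq_iff _).2 ⟨⟨hpos, by rw [hback]; exact x.2⟩, ?_⟩
    rintro m hm ⟨hm0, hmleg⟩
    refine Nat.find_min (B.exists_return c x) (m := B.returnTime c x - m)
      (Nat.sub_lt hpos hm0) ⟨Nat.sub_pos_of_lt hm, ?_⟩
    have h1 := B.edge_zero_pow c (B.otherEnd c x) m
    rw [hmleg] at h1
    have h2 : (B.faceStep c ^ m) ((B.faceStep c ^ (B.returnTime c x - m)) x.1)
        = (B.otherEnd c x).1 := by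
      rw [← Equiv.Perm.mul_apply, ← pow_add, Nat.add_sub_cancel' hm.le]; rfl
    rw [← (B.faceStep c ^ m).injective (h1.trans h2.symm)]
    exact hmleg
  apply Subtype.ext
  change (B.faceStep c ^ B.returnTime c (B.otherEnd c x)) (B.otherEnd c x).1 = x.1
  rw [htime, hback]

open Classical in
theorem white_otherEnd [Finite X] (c : Fin (n + 1)) (hc : ∀ x, B.edge c x ≠ x) (x : B.Leg) :
    B.white (B.otherEnd c x).1 = !B.white x.1 := by
  obtain ⟨hpos, -⟩ := Nat.find_spec (B.exists_return c x)
  have key : ∀ k, k < B.returnTime c x →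
      B.white ((B.faceStep c ^ (k + 1)) x.1) = !B.white x.1 := by
    intro k
    induction k with
    | zero =>
      intro _
      simp only [zero_add, pow_one, faceStep, Equiv.Perm.mul_apply, x.2]
      exact B.bipartite c _ (hc _)
    | succ k ih =>
      intro hk
      have hne : B.edge 0 ((B.faceStep c ^ (k + 1)) x.1) ≠ (B.faceStep c ^ (k + 1)) x.1 :=
        fun h => Nat.find_min (B.exists_return c x) hk ⟨Nat.succ_pos k, h⟩
      rw [pow_succ', Equiv.Perm.mul_apply]
      simp only [faceStep, Equiv.Perm.mul_apply]
      rw [B.bipartite c _ (hc _)]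
      have h0 := B.bipartite 0 _ hne
      simp only [faceStep] at h0
      rw [h0]
      have h1 := ih (Nat.lt_of_succ_lt hk)
      simp only [faceStep] at h1
      rw [h1]
      simp
  have h := key (B.returnTime c x - 1) (Nat.sub_lt hpos one_pos)
  rwa [show B.returnTime c x - 1 + 1 = B.returnTime c x from Nat.sub_add_cancel hpos] at h

/-- The boundary graph of a colored graph all of whose external legs have color `0`. Its vertices
are the external legs; its lines of color `a` are the open faces of colors `0` and `a.succ`, each
joining the two legs at its ends. It is a closed graph with one color less. -/
noncomputable def boundary [Finite X] (hB : ∀ (a : Fin n) x, B.edge a.succ x ≠ x) :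
    ColoredGraph n B.Leg where
  white x := B.white x.1
  edge a := Function.Involutive.toPerm (B.otherEnd a.succ) (B.otherEnd_otherEnd a.succ)
  edge_edge a := B.otherEnd_otherEnd a.succ
  bipartite a x _ := B.white_otherEnd a.succ (hB a) x

end ColoredGraph

/-! ### Feynman graphs of the four-dimensional tensor model -/

/-- The vertices of the model. The permutation `π` of the four colors says which of the 24 colored
versions of the trace invariant is meant. -/
inductive InteractionKind
  /-- A vertex of `S_{6;1}`. -/
  | sextic1 (π : Equiv.Perm (Fin 4))
  /-- A vertex of `S_{6;2}`. -/
  | sextic2 (π : Equiv.Perm (Fin 4))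
  /-- A vertex of `S_{4;1}`. -/
  | quartic (π : Equiv.Perm (Fin 4))
  /-- A mass counterterm `∫ φ̄ φ`. -/
  | mass
  /-- A wave function counterterm `∫ φ̄ (-Δ) φ`. -/
  | wave
  /-- One of the two factors `∫ φ̄ φ` of an anomalous vertex `(∫ φ̄ φ)²`. -/
  | anomalousHalf

namespace InteractionKind

/-- The number of fields of a vertex. -/
def arity : InteractionKind → ℕ
  | sextic1 _ => 6
  | sextic2 _ => 6
  | quartic _ => 4
  | mass => 2
  | wave => 2
  | anomalousHalf => 2

/-- Contraction of the indices of color `s` in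
`φ₁₂₃₄ φ̄₁'₂₃₄ φ₁'₂'₃'₄' φ̄₁''₂'₃'₄' φ₁''₂''₃''₄'' φ̄₁₂''₃''₄''`. -/
def sexticPattern1 (s : Fin 4) : Equiv.Perm (Fin 6) :=
  if s = 0 then Equiv.swap 0 5 * Equiv.swap 1 2 * Equiv.swap 3 4
  else Equiv.swap 0 1 * Equiv.swap 2 3 * Equiv.swap 4 5

/-- Contraction of the indices of color `s` in
`φ₁₂₃₄ φ̄₁'₂'₃'₄ φ₁'₂'₃'₄' φ̄₁''₂₃₄' φ₁''₂''₃''₄'' φ̄₁₂''₃''₄''`. -/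
def sexticPattern2 (s : Fin 4) : Equiv.Perm (Fin 6) :=
  if s = 0 then Equiv.swap 0 5 * Equiv.swap 1 2 * Equiv.swap 3 4
  else if s = 3 then Equiv.swap 0 1 * Equiv.swap 2 3 * Equiv.swap 4 5
  else Equiv.swap 0 3 * Equiv.swap 1 2 * Equiv.swap 4 5

/-- Contraction of the indices of color `s` in `φ₁₂₃₄ φ̄₁'₂₃₄ φ₁'₂'₃'₄' φ̄₁₂'₃'₄'`. -/
def quarticPattern (s : Fin 4) : Equiv.Perm (Fin 4) :=
  if s = 0 then Equiv.swap 0 3 * Equiv.swap 1 2 else Equiv.swap 0 1 * Equiv.swap 2 3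

/-- `k.strand a` exchanges the two ends of each strand of color `a` of a vertex of kind `k`. The
fields at even places are `φ`, those at odd places are `φ̄`. -/
def strand : (k : InteractionKind) → Fin 4 → Equiv.Perm (Fin k.arity)
  | sextic1 π, a => sexticPattern1 (π.symm a)
  | sextic2 π, a => sexticPattern2 (π.symm a)
  | quartic π, a => quarticPattern (π.symm a)
  | mass, _ => (Equiv.swap 0 1 : Equiv.Perm (Fin 2))
  | wave, _ => (Equiv.swap 0 1 : Equiv.Perm (Fin 2))
  | anomalousHalf, _ => (Equiv.swap 0 1 : Equiv.Perm (Fin 2))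

theorem strand_strand (k : InteractionKind) (a : Fin 4) (i : Fin k.arity) :
    k.strand a (k.strand a i) = i := by
  cases k with
  | sextic1 π =>
    exact (by decide : ∀ s i, sexticPattern1 s (sexticPattern1 s i) = i) _ _
  | sextic2 π =>
    exact (by decide : ∀ s i, sexticPattern2 s (sexticPattern2 s i) = i) _ _
  | quartic π =>
    exact (by decide : ∀ s i, quarticPattern s (quarticPattern s i) = i) _ _
  | mass => exact (by decide : ∀ i : Fin 2, Equiv.swap 0 1 (Equiv.swap 0 1 i) = i) i
  | wave => exact (by decide : ∀ i : Fin 2, Equiv.swap 0 1 (Equiv.swap 0 1 i) = i) i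
  | anomalousHalf => exact (by decide : ∀ i : Fin 2, Equiv.swap 0 1 (Equiv.swap 0 1 i) = i) i

theorem strand_parity (k : InteractionKind) (a : Fin 4) (i : Fin k.arity) :
    decide ((k.strand a i).1 % 2 = 0) = !decide (i.1 % 2 = 0) := by
  cases k with
  | sextic1 π =>
    exact (by decide : ∀ s (i : Fin 6),
      decide ((sexticPattern1 s i).1 % 2 = 0) = !decide (i.1 % 2 = 0)) _ _
  | sextic2 π =>
    exact (by decide : ∀ s (i : Fin 6),
      decide ((sexticPattern2 s i).1 % 2 = 0) = !decide (i.1 % 2 = 0)) _ _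
  | quartic π =>
    exact (by decide : ∀ s (i : Fin 4),
      decide ((quarticPattern s i).1 % 2 = 0) = !decide (i.1 % 2 = 0)) _ _
  | mass => exact (by decide : ∀ i : Fin 2,
      decide ((Equiv.swap 0 1 i).1 % 2 = 0) = !decide (i.1 % 2 = 0)) i
  | wave => exact (by decide : ∀ i : Fin 2,
      decide ((Equiv.swap 0 1 i).1 % 2 = 0) = !decide (i.1 % 2 = 0)) i
  | anomalousHalf => exact (by decide : ∀ i : Fin 2,
      decide ((Equiv.swap 0 1 i).1 % 2 = 0) = !decide (i.1 % 2 = 0)) i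

end InteractionKind

/-- The half-lines (fields) attached to the vertices. -/
abbrev HalfLine {V : Type*} (kind : V → InteractionKind) : Type _ := Σ v : V, Fin (kind v).arity

/-- `true` for a field `φ`, `false` for a field `φ̄`. -/
def HalfLine.isPhi {V : Type*} {kind : V → InteractionKind} (h : HalfLine kind) : Bool :=
  decide (h.2.1 % 2 = 0)

/-- An amputated Feynman graph with vertex set `V`: each line joins a field `φ` to a field `φ̄`, and
the half-lines fixed by `line` are the external legs. -/
structure FeynmanGraph (V : Type*) where
  kind : V → InteractionKind
  line : Equiv.Perm (HalfLine kind)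
  line_line : ∀ h, line (line h) = h
  line_isPhi : ∀ h, line h ≠ h → HalfLine.isPhi (line h) = !HalfLine.isPhi h

namespace FeynmanGraph

open InteractionKind

variable {V : Type*} (G : FeynmanGraph V)

/-- Any two vertices are linked by a chain of lines, and there is at least one vertex. -/
def Connected : Prop :=
  (SimpleGraph.fromRel fun v w : V => ∃ h : HalfLine G.kind, h.1 = v ∧ (G.line h).1 = w).Connected

/-- The number `V_4` of vertices of type `S_{4;1}`. -/
noncomputable def numQuartic : ℕ := Nat.card {v : V // ∃ π, G.kind v = quartic π}

/-- The number `V_2` of mass vertices. -/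
noncomputable def numMass : ℕ := Nat.card {v : V // G.kind v = mass}

/-- The number `V_2′` of wave function vertices. -/
noncomputable def numWave : ℕ := Nat.card {v : V // G.kind v = wave}

/-- The number `V_2″` of two-point halves of anomalous vertices. -/
noncomputable def numAnomalousHalf : ℕ := Nat.card {v : V // G.kind v = anomalousHalf}

/-- The number `L` of internal lines. -/
noncomputable def numLines : ℕ := Nat.card {h : HalfLine G.kind // G.line h ≠ h} / 2

/-- The number `N_ext` of external legs. -/
noncomputable def numExternal : ℕ := Nat.card {h : HalfLine G.kind // G.line h = h}

/-- The strands of color `a` inside the vertices. -/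
def vertexStrand (a : Fin 4) : Equiv.Perm (HalfLine G.kind) :=
  Equiv.Perm.sigmaCongrRight fun v => (G.kind v).strand a

/-- The faces of color `a`, closed or open: the circuits or paths formed by the strands of color
`a` of the vertices and of the lines. -/
abbrev Face (a : Fin 4) : Type _ :=
  MulAction.orbitRel.Quotient (Subgroup.closure {G.vertexStrand a, G.line}) (HalfLine G.kind)

/-- A face is internal (closed) if it contains no external leg. -/
def Face.IsInternal {G : FeynmanGraph V} {a : Fin 4} (f : G.Face a) : Prop :=
  ∀ h ∈ f.orbit, G.line h ≠ h

/-- The number `F` of internal faces. -/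
noncomputable def numFaces : ℕ := ∑ a : Fin 4, Nat.card {f : G.Face a // f.IsInternal}

/-- The divergence degree `-2 L + F + 2 V_2′`. -/
noncomputable def divergenceDegree : ℤ := -2 * G.numLines + G.numFaces + 2 * G.numWave

/-- The colored extension: each field becomes a five-valent vertex, the lines of the graph become
the lines of color `0`, and the strands of color `a` inside the vertices become the lines of color
`a + 1`. -/
def coloredExtension : ColoredGraph 5 (HalfLine G.kind) where
  white := HalfLine.isPhi
  edge := Fin.cons G.line G.vertexStrand
  edge_edge c h := by
    refine Fin.cases ?_ (fun a => ?_) c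
    · exact G.line_line h
    · simp [vertexStrand, strand_strand]
  bipartite c h := by
    refine Fin.cases ?_ (fun a _ => ?_) c
    · exact G.line_isPhi h
    · exact strand_parity (G.kind h.1) a h.2

theorem coloredExtension_edge_succ_ne (a : Fin 4) (h : HalfLine G.kind) :
    G.coloredExtension.edge a.succ h ≠ h := by
  intro e
  have hp : HalfLine.isPhi (G.coloredExtension.edge a.succ h) = !HalfLine.isPhi h :=
    strand_parity (G.kind h.1) a h.2
  rw [e] at hp
  cases hh : HalfLine.isPhi h <;> simp [hh] at hp

/-- The boundary graph of a Feynman graph: a closed graph with four colors. -/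
noncomputable def boundaryGraph [Finite V] : ColoredGraph 4 G.coloredExtension.Leg :=
  G.coloredExtension.boundary G.coloredExtension_edge_succ_ne

end FeynmanGraph

/-! ### Counting classes of relations -/

/-! A genus is an alternating count of vertices, lines and faces, so both genus sums reduce to
counting faces by pairs of colors. Let H be the number of half-lines. A jacket of the colored
extension has one component, H vertices and L + 2H lines, and its pinched faces are of two kinds.
Those avoiding the legs are the closed two-colored faces whose colors are adjacent in the cycle
(`card_internalFaces`). Those through a leg are the faces of the boundary graph in the two
neighbours of color 0 (`card_legFaces`): the walk runs along open faces and at each leg turns from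
one neighbour of 0 to the other.

Two colors are adjacent in 6 of the 12 jackets, two colors are the neighbours of 0 in 2 of the 12,
and two colors are adjacent in 2 of the 3 boundary jackets. Hence the boundary faces enter both sums
with the same coefficient and cancel in the difference. What remains are the F internal faces and
the faces inside the interaction vertices: 12 for a sextic, 9 for a quartic, 6 for a two-point
vertex. This is twice the arity, plus 1 for quartic and plus 2 for two-point vertices
(`sum_numFacePairs`), which produces the vertex terms of the formula.

Orbits are treated as quotients by the one-step relation `OrbitStep`, so that maps between them need
checking on generators only. -/

theorem Nat.card_quot_congr {α β : Type*} {r : α → α → Prop} {s : β → β → Prop}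
    (φ : α → β) (ψ : β → α)
    (hφ : ∀ x y, r x y → Quot.mk s (φ x) = Quot.mk s (φ y))
    (hψ : ∀ x y, s x y → Quot.mk r (ψ x) = Quot.mk r (ψ y))
    (h₁ : ∀ x, Quot.mk r (ψ (φ x)) = Quot.mk r x)
    (h₂ : ∀ y, Quot.mk s (φ (ψ y)) = Quot.mk s y) :
    Nat.card (Quot r) = Nat.card (Quot s) :=
  Nat.card_congr
    { toFun := Quot.lift (fun x => Quot.mk s (φ x)) hφ
      invFun := Quot.lift (fun y => Quot.mk r (ψ y)) hψ
      left_inv := by rintro ⟨x⟩; exact h₁ x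
      right_inv := by rintro ⟨y⟩; exact h₂ y }

theorem Nat.card_quot_sigma {ι : Type*} [Fintype ι] {α : ι → Type*} [∀ i, Finite (α i)]
    (r : ∀ i, α i → α i → Prop) (R : (Σ i, α i) → (Σ i, α i) → Prop)
    (h₁ : ∀ i a b, r i a b → R ⟨i, a⟩ ⟨i, b⟩)
    (h₂ : ∀ p q, R p q → ∃ i a b, p = ⟨i, a⟩ ∧ q = ⟨i, b⟩ ∧ r i a b) :
    Nat.card (Quot R) = ∑ i, Nat.card (Quot (r i)) := by
  rw [← Nat.card_sigma]
  refine Nat.card_congr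
    { toFun := Quot.lift (fun p => ⟨p.1, Quot.mk _ p.2⟩) ?_
      invFun := fun q => Quot.lift (fun a => Quot.mk R ⟨q.1, a⟩)
        (fun a b h => Quot.sound (h₁ _ _ _ h)) q.2
      left_inv := ?_
      right_inv := ?_ }
  · intro p q h
    obtain ⟨i, a, b, rfl, rfl, h'⟩ := h₂ p q h
    exact congrArg (Sigma.mk i) (Quot.sound h')
  · rintro ⟨p⟩; rfl
  · rintro ⟨i, ⟨a⟩⟩; rfl

/-- Classes with a given property are the classes of the restricted relation. -/
def Quot.subtypeEquiv {α : Type*} {r : α → α → Prop} (P : Quot r → Prop) :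
    (Quot fun x y : {x : α // P (Quot.mk r x)} => r x.1 y.1) ≃ {q : Quot r // P q} where
  toFun := Quot.lift (fun x => ⟨Quot.mk r x.1, x.2⟩)
    (fun x y h => Subtype.ext (Quot.sound (r := r) h))
  invFun := fun q => Quot.hrecOn (motive := fun q => P q →
      Quot fun x y : {x : α // P (Quot.mk r x)} => r x.1 y.1) q.1
    (fun x hx => Quot.mk _ ⟨x, hx⟩)
    (fun x y h => Function.hfunext (by rw [Quot.sound h]) fun hx hy _ =>
      heq_of_eq (Quot.sound h)) q.2
  left_inv := by rintro ⟨x⟩; rfl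
  right_inv := by rintro ⟨⟨x⟩, hx⟩; rfl

/-- Since `P` depends on the class only, a chain of steps between two points satisfying it never
leaves the subtype. -/
theorem Quot.mk_subtype_eq {α : Type*} {r : α → α → Prop} (P : Quot r → Prop)
    {x y : {x : α // P (Quot.mk r x)}} (h : Quot.mk r x.1 = Quot.mk r y.1) :
    (Quot.mk _ x : Quot fun x y : {x : α // P (Quot.mk r x)} => r x.1 y.1) = Quot.mk _ y :=
  (Quot.subtypeEquiv P).injective (Subtype.ext h)

/-! ### Orbits as classes of a relation -/

/-- `y` is the image of `x` under a permutation in `S`. -/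
def OrbitStep {X : Type*} (S : Set (Equiv.Perm X)) (x y : X) : Prop := ∃ s ∈ S, s x = y

namespace OrbitStep

variable {X : Type*} {S : Set (Equiv.Perm X)}

theorem mk_apply {s : Equiv.Perm X} (hs : s ∈ S) (x : X) :
    Quot.mk (OrbitStep S) (s x) = Quot.mk (OrbitStep S) x :=
  (Quot.sound ⟨s, hs, rfl⟩).symm

theorem mk_smul (g : Subgroup.closure S) (x : X) :
    Quot.mk (OrbitStep S) (g • x) = Quot.mk (OrbitStep S) x := by
  obtain ⟨g, hg⟩ := g
  change Quot.mk (OrbitStep S) (g x) = _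
  induction hg using Subgroup.closure_induction generalizing x with
  | mem s hs => exact mk_apply hs x
  | one => rfl
  | mul g h _ _ ihg ihh => rw [Equiv.Perm.mul_apply, ihg, ihh]
  | inv g _ ih => rw [← ih (g⁻¹ x), ← Equiv.Perm.mul_apply, mul_inv_cancel, Equiv.Perm.one_apply]

/-- Orbits of the generated group are the classes of the relation. -/
def quotEquiv (S : Set (Equiv.Perm X)) :
    Quot (OrbitStep S) ≃ MulAction.orbitRel.Quotient (Subgroup.closure S) X where
  toFun := Quot.lift (fun x => Quotient.mk _ x) <| by
    rintro x y ⟨s, hs, rfl⟩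
    exact (Quotient.sound (MulAction.orbitRel_apply.2
      ⟨(⟨s, Subgroup.subset_closure hs⟩ : Subgroup.closure S), rfl⟩)).symm
  invFun := Quotient.lift (fun x => Quot.mk _ x) <| by
    rintro x y ⟨g, rfl⟩
    exact mk_smul g y
  left_inv := by rintro ⟨x⟩; rfl
  right_inv := by rintro ⟨x⟩; rfl

theorem numOrbits_eq (S : Set (Equiv.Perm X)) : numOrbits S = Nat.card (Quot (OrbitStep S)) :=
  (Nat.card_congr (quotEquiv S)).symm

theorem mk_eq_mk_iff {x y : X} :
    Quot.mk (OrbitStep S) x = Quot.mk (OrbitStep S) y ↔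
      MulAction.orbitRel (Subgroup.closure S) X x y := by
  rw [← (quotEquiv S).apply_eq_iff_eq]
  exact Quotient.eq

theorem mk_singleton_pow (f : Equiv.Perm X) (k : ℕ) (x : X) :
    Quot.mk (OrbitStep {f}) ((f ^ k) x) = Quot.mk (OrbitStep {f}) x := by
  induction k with
  | zero => rfl
  | succ k ih => rw [pow_succ', Equiv.Perm.mul_apply, mk_apply (Set.mem_singleton f), ih]

theorem exists_pow_of_mk_eq [Finite X] {f : Equiv.Perm X} {x y : X}
    (h : Quot.mk (OrbitStep {f}) x = Quot.mk (OrbitStep {f}) y) : ∃ k : ℕ, (f ^ k) x = y := by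
  obtain ⟨⟨g, hg⟩, hgx⟩ := mk_eq_mk_iff.1 h.symm
  obtain ⟨m, rfl⟩ := Subgroup.mem_closure_singleton.1 hg
  obtain ⟨k, -, hk⟩ := Equiv.Perm.SameCycle.exists_pow_eq' (f := f) (x := x) (y := y) ⟨m, hgx⟩
  exact ⟨k, hk⟩

/-- The cycles of `f` that meet the range of `ι` are counted by the first return map to it. -/
theorem card_quot_firstReturn [Finite X] {Y : Type*} (f : Equiv.Perm X) {ι : Y → X}
    (hι : Function.Injective ι) {R : Y → Y → Prop}
    (hR : ∀ y z, R y z → Quot.mk (OrbitStep {f}) (ι y) = Quot.mk (OrbitStep {f}) (ι z))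
    (hfirst : ∀ y, ∃ z m, 0 < m ∧ (f ^ m) (ι y) = ι z ∧ Quot.mk R y = Quot.mk R z ∧
      ∀ j, 0 < j → j < m → (f ^ j) (ι y) ∉ Set.range ι) :
    Nat.card {q : Quot (OrbitStep {f}) // ∃ y, Quot.mk _ (ι y) = q} = Nat.card (Quot R) := by
  -- Jump from return to return. A visit after `k` steps cannot precede the first return time `m`,
  -- so `m ≤ k` and `k - m` steps remain.
  have key : ∀ k y z, (f ^ k) (ι y) = ι z → Quot.mk R y = Quot.mk R z := by
    intro k
    induction k using Nat.strong_induction_on with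
    | _ k ih =>
      intro y z h
      rcases Nat.eq_zero_or_pos k with rfl | hk
      · rw [hι h]
      obtain ⟨w, m, hm, hw, hyw, hj⟩ := hfirst y
      rcases lt_or_ge k m with hkm | hkm
      · exact absurd ⟨z, h.symm⟩ (hj k hk hkm)
      · rw [hyw]
        refine ih (k - m) (Nat.sub_lt hk hm) w z ?_
        rw [← hw, ← Equiv.Perm.mul_apply, ← pow_add, Nat.sub_add_cancel hkm, h]
  refine (Nat.card_congr (Equiv.ofBijective
    (Quot.lift (fun y => ⟨Quot.mk _ (ι y), y, rfl⟩) fun y z h => Subtype.ext (hR y z h))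
    ⟨?_, ?_⟩)).symm
  · rintro ⟨y⟩ ⟨z⟩ h
    obtain ⟨k, hk⟩ := exists_pow_of_mk_eq (Subtype.ext_iff.1 h)
    exact key k y z hk
  · rintro ⟨-, y, rfl⟩
    exact ⟨Quot.mk _ y, rfl⟩

end OrbitStep

/-! ### Jackets -/

/-- The division by 2 in the definition is exact, because an involution moves an even number of
points. -/
theorem RibbonGraph.two_mul_numLines {H : Type*} [Finite H] (R : RibbonGraph H) :
    2 * R.numLines = Nat.card {h : H // R.link h ≠ h} := by
  classical
  have := Fintype.ofFinite H
  refine Nat.mul_div_cancel' ?_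
  rw [Nat.card_eq_fintype_card, Fintype.card_subtype]
  exact Equiv.Perm.two_dvd_card_support (σ := R.link) (by ext h; simp [sq, R.link_link])

namespace ColoredGraph

variable {n : ℕ} {X : Type*}

theorem jacket_rot_apply (B : ColoredGraph n X) (τ : Equiv.Perm (Fin n)) (p : X × Fin n) :
    (B.jacket τ).rot p = (p.1, (if B.white p.1 then τ else τ⁻¹) p.2) := rfl

/-- The rotation alone joins all half-lines at a vertex, as `τ` is a single cycle on the colors. At
a black vertex its steps are read backwards. -/
theorem mk_rot_orbit (B : ColoredGraph n X) {τ : Equiv.Perm (Fin n)} (hτ : ∀ c d, τ.SameCycle c d)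
    {S : Set (Equiv.Perm (X × Fin n))} (hS : (B.jacket τ).rot ∈ S) (x : X) (c d : Fin n) :
    Quot.mk (OrbitStep S) (x, c) = Quot.mk (OrbitStep S) (x, d) := by
  have hτ1 : ∀ c, Quot.mk (OrbitStep S) (x, τ c) = Quot.mk (OrbitStep S) (x, c) := by
    intro c
    have h := OrbitStep.mk_apply hS (x, c)
    have h' := OrbitStep.mk_apply hS (x, τ c)
    rw [jacket_rot_apply] at h h'
    cases hx : B.white x
    · simpa [hx] using h'.symm
    · simpa [hx] using h
  obtain ⟨k, -, rfl⟩ := (hτ c d).exists_pow_eq'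
  induction k with
  | zero => rfl
  | succ k ih => rw [pow_succ', Equiv.Perm.mul_apply, hτ1, ih]

theorem numVertices_jacket [NeZero n] (B : ColoredGraph n X) {τ : Equiv.Perm (Fin n)}
    (hτ : ∀ c d, τ.SameCycle c d) : (B.jacket τ).numVertices = Nat.card X := by
  rw [RibbonGraph.numVertices, OrbitStep.numOrbits_eq]
  refine Nat.card_congr
    { toFun := Quot.lift Prod.fst ?_
      invFun := fun x => Quot.mk _ (x, 0)
      left_inv := ?_
      right_inv := fun x => rfl }
  · rintro p q ⟨s, rfl, rfl⟩
    rfl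
  · rintro ⟨x, c⟩
    exact B.mk_rot_orbit hτ (Set.mem_singleton _) x _ _

theorem numComponents_jacket [NeZero n] (B : ColoredGraph n X) {τ : Equiv.Perm (Fin n)}
    (hτ : ∀ c d, τ.SameCycle c d) : (B.jacket τ).numComponents = B.numComponents := by
  rw [RibbonGraph.numComponents, numComponents, OrbitStep.numOrbits_eq, OrbitStep.numOrbits_eq]
  have hrot : (B.jacket τ).rot ∈ ({(B.jacket τ).rot, (B.jacket τ).link} : Set _) := Or.inl rfl
  have hlink : (B.jacket τ).link ∈ ({(B.jacket τ).rot, (B.jacket τ).link} : Set _) := Or.inr rfl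
  refine Nat.card_quot_congr Prod.fst (fun x => (x, 0)) ?_ ?_ ?_ (fun _ => rfl)
  · rintro ⟨x, c⟩ q ⟨s, rfl | rfl, rfl⟩
    · rfl
    · exact (OrbitStep.mk_apply (Set.mem_range_self c) x).symm
  · rintro x y ⟨-, ⟨c, rfl⟩, rfl⟩
    rw [B.mk_rot_orbit hτ hrot x 0 c, B.mk_rot_orbit hτ hrot (B.edge c x) 0 c]
    exact (OrbitStep.mk_apply hlink (x, c)).symm
  · rintro ⟨x, c⟩
    exact B.mk_rot_orbit hτ hrot x _ _

theorem two_mul_numLines_jacket [Finite X] (B : ColoredGraph n X) (τ : Equiv.Perm (Fin n)) :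
    2 * (B.jacket τ).numLines = ∑ c, Nat.card {x : X // B.edge c x ≠ x} := by
  rw [RibbonGraph.two_mul_numLines, ← Nat.card_sigma]
  refine Nat.card_congr
    { toFun := fun p => ⟨p.1.2, p.1.1, fun h => p.2 (Prod.ext h rfl)⟩
      invFun := fun q => ⟨(q.2.1, q.1), fun h => q.2.2 (congrArg Prod.fst h)⟩
      left_inv := fun p => rfl
      right_inv := fun q => rfl }

/-! ### Faces of jackets -/

/-- The number of faces of colors `k` and `l` that contain no external leg. -/
noncomputable def numClosedFaces (B : ColoredGraph n X) (k l : Fin n) : ℕ :=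
  Nat.card {q : Quot (OrbitStep {B.edge k, B.edge l}) //
    ∀ x, Quot.mk _ x = q → B.edge k x ≠ x ∧ B.edge l x ≠ x}

theorem numClosedFaces_comm (B : ColoredGraph n X) (k l : Fin n) :
    B.numClosedFaces k l = B.numClosedFaces l k := by
  unfold numClosedFaces
  rw [Set.pair_comm]
  simp only [and_comm]

theorem numClosedFaces_of_closed (B : ColoredGraph n X) {k l : Fin n}
    (hk : ∀ x, B.edge k x ≠ x) (hl : ∀ x, B.edge l x ≠ x) :
    B.numClosedFaces k l = Nat.card (Quot (OrbitStep {B.edge k, B.edge l})) :=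
  Nat.card_congr (Equiv.subtypeUnivEquiv fun _ x _ => ⟨hk x, hl x⟩)

/-- The walk along the faces of the pinched jacket. -/
def faceWalk (B : ColoredGraph n X) (τ : Equiv.Perm (Fin n)) : Equiv.Perm (X × Fin n) :=
  (B.jacket τ).rot * (B.jacket τ).link

theorem faceWalk_apply (B : ColoredGraph n X) (τ : Equiv.Perm (Fin n)) (x : X) (c : Fin n) :
    B.faceWalk τ (x, c) =
      (B.edge c x, (if B.white (B.edge c x) then τ else τ⁻¹) c) := rfl

/-- The face of the pinched jacket through the half-line `p`. -/
def faceMk (B : ColoredGraph n X) (τ : Equiv.Perm (Fin n)) (p : X × Fin n) :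
    Quot (OrbitStep {B.faceWalk τ}) := Quot.mk _ p

theorem faceMk_step (B : ColoredGraph n X) (τ : Equiv.Perm (Fin n)) (x : X) (c : Fin n) :
    B.faceMk τ (B.edge c x, (if B.white (B.edge c x) then τ else τ⁻¹) c) = B.faceMk τ (x, c) :=
  OrbitStep.mk_apply (Set.mem_singleton (B.faceWalk τ)) (x, c)

/-- The color under which the face of colors `k`, `τ⁻¹ k` leaves `x`. -/
def outColor (B : ColoredGraph n X) (τ : Equiv.Perm (Fin n)) (k : Fin n) (x : X) : Fin n :=
  if B.white x then k else τ⁻¹ k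

/-- The color `k` such that the half-line `p` is left along the face of colors `k`, `τ⁻¹ k`. -/
def faceColor (B : ColoredGraph n X) (τ : Equiv.Perm (Fin n)) (p : X × Fin n) : Fin n :=
  if B.white p.1 then p.2 else τ p.2

theorem outColor_faceColor (B : ColoredGraph n X) (τ : Equiv.Perm (Fin n)) (p : X × Fin n) :
    B.outColor τ (B.faceColor τ p) p.1 = p.2 := by
  unfold outColor faceColor; split_ifs <;> simp

theorem faceColor_outColor (B : ColoredGraph n X) (τ : Equiv.Perm (Fin n)) (k : Fin n) (x : X) :
    B.faceColor τ (x, B.outColor τ k x) = k := by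
  unfold outColor faceColor; split_ifs <;> simp

theorem white_edge (B : ColoredGraph n X) {c : Fin n} {x : X} (h : B.edge c x ≠ x) :
    B.white (B.edge c x) = !B.white x := B.bipartite c x h

/-- The walk has a direction, the two-colored orbit has none. If the face leaves `x` by color `c`,
the step from `x` is used; otherwise the walk arrives at `x` over this line, and the step from `edge
c x` is used. -/
theorem faceMk_edge (B : ColoredGraph n X) (τ : Equiv.Perm (Fin n)) (k : Fin n) {c : Fin n}
    (hc : c = k ∨ c = τ⁻¹ k) {x : X} (h : B.edge c x ≠ x) :
    B.faceMk τ (B.edge c x, B.outColor τ k (B.edge c x)) = B.faceMk τ (x, B.outColor τ k x) := by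
  have h1 := B.faceMk_step τ x c
  have h2 := B.faceMk_step τ (B.edge c x) c
  have hw := B.white_edge h
  rw [B.edge_edge] at h2
  unfold outColor
  rcases hc with rfl | rfl <;> cases hx : B.white x <;> simp_all

/-- The face leaves `x` by one of the two colors. A leg of the other color would send the walk back
at `x` into the outgoing half-line, so this leg would lie on the same face. -/
theorem edge_ne_of_internal (B : ColoredGraph n X) (τ : Equiv.Perm (Fin n)) (k : Fin n) {x : X}
    (h : ∀ p : X × Fin n, B.faceMk τ p = B.faceMk τ (x, B.outColor τ k x) → B.edge p.2 p.1 ≠ p.1) :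
    B.edge k x ≠ x ∧ B.edge (τ⁻¹ k) x ≠ x := by
  have h0 := h _ rfl
  constructor
  · intro e
    have h1 := B.faceMk_step τ x k
    rw [e] at h1
    cases hx : B.white x
    · exact h (x, k) (by rw [← h1]; simp [outColor, hx]) e
    · exact h0 (by simpa [outColor, hx] using e)
  · intro e
    have h1 := B.faceMk_step τ x (τ⁻¹ k)
    rw [e] at h1
    cases hx : B.white x
    · exact h0 (by simpa [outColor, hx] using e)
    · exact h (x, τ⁻¹ k) (by rw [← h1]; simp [outColor, hx]) e

end ColoredGraph

theorem OrbitStep.iff_of_mk_eq {X : Type*} {S : Set (Equiv.Perm X)} {P : X → Prop}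
    (hP : ∀ s ∈ S, ∀ x, P x ↔ P (s x)) {x y : X}
    (h : Quot.mk (OrbitStep S) x = Quot.mk (OrbitStep S) y) : P x ↔ P y := by
  have hlift : ∀ x y, OrbitStep S x y → P x = P y := by
    rintro x y ⟨s, hs, rfl⟩
    exact propext (hP s hs x)
  exact iff_of_eq (congrArg (Quot.lift P hlift) h)

namespace ColoredGraph

variable {n : ℕ} {X : Type*}

/-- No external leg lies on the face of colors `k`, `l` through `x`. -/
def OnClosedFace (B : ColoredGraph n X) (k l : Fin n) (x : X) : Prop :=
  ∀ y, Quot.mk (OrbitStep {B.edge k, B.edge l}) y = Quot.mk _ x →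
    B.edge k y ≠ y ∧ B.edge l y ≠ y

/-- No external leg lies on the face of the pinched jacket through `p`. -/
def OnInternalFace (B : ColoredGraph n X) (τ : Equiv.Perm (Fin n)) (p : X × Fin n) : Prop :=
  ∀ q : X × Fin n, B.faceMk τ q = B.faceMk τ p → B.edge q.2 q.1 ≠ q.1

theorem OnInternalFace.congr {B : ColoredGraph n X} {τ : Equiv.Perm (Fin n)} {p q : X × Fin n}
    (h : B.faceMk τ p = B.faceMk τ q) : B.OnInternalFace τ p ↔ B.OnInternalFace τ q := by
  unfold OnInternalFace; rw [h]

theorem OnClosedFace.congr {B : ColoredGraph n X} {k l : Fin n} {x y : X}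
    (h : Quot.mk (OrbitStep {B.edge k, B.edge l}) x = Quot.mk _ y) :
    B.OnClosedFace k l x ↔ B.OnClosedFace k l y := by
  unfold OnClosedFace; rw [h]

theorem mk_edge_pair (B : ColoredGraph n X) (k l : Fin n) {c : Fin n} (hc : c = k ∨ c = l)
    (x : X) : Quot.mk (OrbitStep {B.edge k, B.edge l}) (B.edge c x) = Quot.mk _ x :=
  OrbitStep.mk_apply (by rcases hc with rfl | rfl <;> simp) x

theorem onInternalFace_edge (B : ColoredGraph n X) (τ : Equiv.Perm (Fin n)) (k : Fin n)
    {c : Fin n} (hc : c = k ∨ c = τ⁻¹ k) {x : X}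
    (h : B.OnInternalFace τ (x, B.outColor τ k x)) :
    B.OnInternalFace τ (B.edge c x, B.outColor τ k (B.edge c x)) := by
  refine (OnInternalFace.congr (B.faceMk_edge τ k hc ?_)).2 h
  have := B.edge_ne_of_internal τ k h
  rcases hc with rfl | rfl
  exacts [this.1, this.2]

theorem onClosedFace_of_onInternalFace (B : ColoredGraph n X) (τ : Equiv.Perm (Fin n))
    {k : Fin n} {x : X} (h : B.OnInternalFace τ (x, B.outColor τ k x)) :
    B.OnClosedFace k (τ⁻¹ k) x := by
  intro y hy
  refine B.edge_ne_of_internal τ k ((OrbitStep.iff_of_mk_eq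
    (P := fun y => B.OnInternalFace τ (y, B.outColor τ k y)) ?_ hy).2 h)
  intro s hs z
  have key : ∃ c, (c = k ∨ c = τ⁻¹ k) ∧ s = B.edge c := by
    rcases hs with rfl | rfl
    exacts [⟨k, Or.inl rfl, rfl⟩, ⟨τ⁻¹ k, Or.inr rfl, rfl⟩]
  obtain ⟨c, hc, rfl⟩ := key
  refine ⟨B.onInternalFace_edge τ k hc, fun h => ?_⟩
  simpa only [B.edge_edge] using B.onInternalFace_edge τ k hc h

theorem color_eq (B : ColoredGraph n X) (τ : Equiv.Perm (Fin n)) (p : X × Fin n) :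
    p.2 = B.faceColor τ p ∨ p.2 = τ⁻¹ (B.faceColor τ p) := by
  unfold faceColor; split_ifs <;> simp

theorem color_eq_faceColor_faceWalk (B : ColoredGraph n X) (τ : Equiv.Perm (Fin n))
    (p : X × Fin n) : p.2 = B.faceColor τ (B.faceWalk τ p) ∨
      p.2 = τ⁻¹ (B.faceColor τ (B.faceWalk τ p)) := by
  obtain ⟨x, c⟩ := p
  rw [faceWalk_apply]
  unfold faceColor
  cases hw : B.white (B.edge c x) <;> simp

/-- Crossing a line exchanges white and black, hence `τ` and `τ⁻¹`, so the pair of colors persists.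
Legs are excluded because there the vertex stays the same and the walk turns into another pair. -/
theorem faceColor_faceWalk (B : ColoredGraph n X) (τ : Equiv.Perm (Fin n)) {p : X × Fin n}
    (h : B.edge p.2 p.1 ≠ p.1) : B.faceColor τ (B.faceWalk τ p) = B.faceColor τ p := by
  obtain ⟨x, c⟩ := p
  have hw := B.white_edge h
  rw [faceWalk_apply]
  unfold faceColor
  cases hx : B.white x <;> simp_all

theorem OnClosedFace.edge_ne {B : ColoredGraph n X} {k l c : Fin n} {x : X}
    (h : B.OnClosedFace k l x) (hc : c = k ∨ c = l) : B.edge c x ≠ x := by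
  have := h x rfl
  rcases hc with rfl | rfl
  exacts [this.1, this.2]

theorem onInternalFace_iff (B : ColoredGraph n X) (τ : Equiv.Perm (Fin n)) (p : X × Fin n) :
    B.OnInternalFace τ p ↔ B.OnClosedFace (B.faceColor τ p) (τ⁻¹ (B.faceColor τ p)) p.1 := by
  constructor
  · intro h
    exact B.onClosedFace_of_onInternalFace τ (by rwa [outColor_faceColor])
  · intro h q hq
    have hq' : B.OnClosedFace (B.faceColor τ q) (τ⁻¹ (B.faceColor τ q)) q.1 := by
      refine (OrbitStep.iff_of_mk_eq (P := fun q =>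
        B.OnClosedFace (B.faceColor τ q) (τ⁻¹ (B.faceColor τ q)) q.1) ?_ hq).2 h
      rintro s rfl q
      constructor
      · intro h
        rw [B.faceColor_faceWalk τ (h.edge_ne (B.color_eq τ q))]
        exact (OnClosedFace.congr (B.mk_edge_pair _ _ (B.color_eq τ q) q.1)).2 h
      · intro h
        have hc := B.color_eq_faceColor_faceWalk τ q
        -- A leg at `q` would be a leg at the image as well, since the walk would stay at the same
        -- vertex, and its color belongs to the face of the image.
        have hne : B.edge q.2 q.1 ≠ q.1 := by
          intro e
          refine h.edge_ne hc ?_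
          change B.edge q.2 (B.edge q.2 q.1) = B.edge q.2 q.1
          rw [e, e]
        have h' := (OnClosedFace.congr (B.mk_edge_pair _ _ hc q.1)).1 h
        rwa [B.faceColor_faceWalk τ hne] at h'
    exact hq'.edge_ne (B.color_eq τ q)

/-- The faces of the pinched jacket that avoid the external legs. -/
theorem card_internalFaces [Finite X] (B : ColoredGraph n X) (τ : Equiv.Perm (Fin n)) :
    Nat.card {q : Quot (OrbitStep {B.faceWalk τ}) //
        ∀ p : X × Fin n, B.faceMk τ p = q → B.edge p.2 p.1 ≠ p.1}
      = ∑ k, B.numClosedFaces k (τ⁻¹ k) := by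
  have hk : ∀ k l, B.numClosedFaces k l = Nat.card (Quot fun x y : {x // B.OnClosedFace k l x} =>
      OrbitStep {B.edge k, B.edge l} x.1 y.1) := fun k l => (Nat.card_congr (Quot.subtypeEquiv _)).symm
  simp only [hk]
  let R : (Σ k, {x // B.OnClosedFace k (τ⁻¹ k) x}) → (Σ k, {x // B.OnClosedFace k (τ⁻¹ k) x}) →
      Prop := fun p q => ∃ k a b, p = ⟨k, a⟩ ∧ q = ⟨k, b⟩ ∧
        OrbitStep {B.edge k, B.edge (τ⁻¹ k)} a.1 b.1
  rw [← Nat.card_quot_sigma (fun k (x y : {x // B.OnClosedFace k (τ⁻¹ k) x}) =>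
    OrbitStep {B.edge k, B.edge (τ⁻¹ k)} x.1 y.1) R
    (fun k a b h => ⟨k, a, b, rfl, rfl, h⟩) (fun _ _ h => h)]
  have hR : ∀ (k l : Fin n) (a : {x // B.OnClosedFace k (τ⁻¹ k) x})
      (b : {x // B.OnClosedFace l (τ⁻¹ l) x}) (c : Fin n), k = l → (c = k ∨ c = τ⁻¹ k) →
      B.edge c a.1 = b.1 → Quot.mk R ⟨k, a⟩ = Quot.mk R ⟨l, b⟩ := by
    rintro k l a b c rfl hc h
    exact Quot.sound ⟨k, a, b, rfl, rfl, B.edge c, by rcases hc with rfl | rfl <;> simp, h⟩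
  -- At a fixed vertex, `faceColor` and `outColor` are inverse bijections between half-lines and
  -- indices `k`; they induce the bijection of faces.
  refine (Nat.card_congr (Quot.subtypeEquiv _)).symm.trans (Nat.card_quot_congr
    (fun p => ⟨B.faceColor τ p.1, p.1.1, (B.onInternalFace_iff τ p.1).1 p.2⟩)
    (fun q => ⟨(q.2.1, B.outColor τ q.1 q.2.1), (B.onInternalFace_iff τ _).2
      (by rw [faceColor_outColor]; exact q.2.2)⟩) ?_ ?_ ?_ ?_)
  · rintro ⟨p, hp⟩ ⟨q, hq⟩ ⟨s, rfl, h⟩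
    change B.faceWalk τ p = q at h
    subst h
    exact hR _ _ _ _ p.2 (B.faceColor_faceWalk τ (hp p rfl)).symm (B.color_eq τ p) rfl
  · rintro - - ⟨k, a, b, rfl, rfl, s, hs, h⟩
    refine Quot.mk_subtype_eq (fun q => ∀ p : X × Fin n, B.faceMk τ p = q → B.edge p.2 p.1 ≠ p.1) ?_
    have key : ∃ c, (c = k ∨ c = τ⁻¹ k) ∧ s = B.edge c := by
      rcases hs with rfl | rfl
      exacts [⟨k, Or.inl rfl, rfl⟩, ⟨τ⁻¹ k, Or.inr rfl, rfl⟩]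
    obtain ⟨c, hc, rfl⟩ := key
    have := B.faceMk_edge τ k hc (a.2.edge_ne hc)
    rw [h] at this
    exact this.symm
  · rintro ⟨p, hp⟩
    simp only [outColor_faceColor]
  · rintro ⟨k, x, hx⟩
    have hext : ∀ (l : Fin n) (hl : B.OnClosedFace l (τ⁻¹ l) x), l = k →
        (⟨l, x, hl⟩ : Σ k, {x // B.OnClosedFace k (τ⁻¹ k) x}) = ⟨k, x, hx⟩ := by
      rintro l hl rfl; rfl
    exact congrArg (Quot.mk R) (hext _ _ (B.faceColor_outColor τ k x))

end ColoredGraph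

/-! ### Faces of the pinched jacket through external legs, and the boundary graph. -/

namespace ColoredGraph

theorem faceStep_pow_succ {n : ℕ} {X : Type*} (B : ColoredGraph (n + 1) X) (c : Fin (n + 1)) (x : X)
    (k : ℕ) :
    (B.faceStep c ^ (k + 1)) x = B.edge c (B.edge 0 ((B.faceStep c ^ k) x)) := by
  rw [pow_succ', Equiv.Perm.mul_apply]; rfl

section Boundary

variable {n : ℕ} {X : Type*} [Finite X] (B : ColoredGraph (n + 1) X)

theorem returnTime_pos (c : Fin (n + 1)) (x : B.Leg) : 0 < B.returnTime c x := by
  classical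
  exact (Nat.find_spec (B.exists_return c x)).1

theorem edge_zero_ne_of_lt_returnTime {c : Fin (n + 1)} {x : B.Leg} {k : ℕ} (hk : 0 < k)
    (hlt : k < B.returnTime c x) :
    B.edge 0 ((B.faceStep c ^ k) x.1) ≠ (B.faceStep c ^ k) x.1 := by
  classical
  exact fun h => Nat.find_min (B.exists_return c x) hlt ⟨hk, h⟩

/-- Before the return, each further round crosses two genuine lines and flips the kind of vertex
twice. At `k = 0` the leg keeps the walk at `x`. -/
theorem white_edge_zero_faceStep_pow {c : Fin (n + 1)} (hc : ∀ x, B.edge c x ≠ x) (x : B.Leg)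
    {k : ℕ} (hk : k < B.returnTime c x) :
    B.white (B.edge 0 ((B.faceStep c ^ k) x.1)) = B.white x.1 := by
  induction k with
  | zero => rw [pow_zero, Equiv.Perm.one_apply, x.2]
  | succ k ih =>
    rw [B.white_edge (B.edge_zero_ne_of_lt_returnTime k.succ_pos hk), faceStep_pow_succ,
      B.white_edge (hc _), ih (Nat.lt_of_succ_lt hk), Bool.not_not]

/-- The color by which the walk along the face of the pinched jacket continues behind a leg. -/
def turnColor (τ : Equiv.Perm (Fin (n + 1))) (x : X) : Fin (n + 1) :=
  (if B.white x then τ else τ⁻¹) 0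

variable {B}

theorem faceWalk_pow_two_mul_add_one (τ : Equiv.Perm (Fin (n + 1))) (x : B.Leg)
    (hc : ∀ y, B.edge (B.turnColor τ x.1) y ≠ y) {k : ℕ}
    (hk : k < B.returnTime (B.turnColor τ x.1) x)
    (h : (B.faceWalk τ ^ (2 * k)) (x.1, 0) = ((B.faceStep (B.turnColor τ x.1) ^ k) x.1, 0)) :
    (B.faceWalk τ ^ (2 * k + 1)) (x.1, 0) =
      (B.edge 0 ((B.faceStep (B.turnColor τ x.1) ^ k) x.1), B.turnColor τ x.1) := by
  rw [pow_succ', Equiv.Perm.mul_apply, h, faceWalk_apply,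
    B.white_edge_zero_faceStep_pow hc x hk]
  rfl

/-- Two steps of the walk make one `faceStep`. The line of color `turnColor` ends at a vertex of the
kind opposite to `x`, where the inverse rotation leads back to color 0. -/
theorem faceWalk_pow_two_mul (τ : Equiv.Perm (Fin (n + 1))) (x : B.Leg)
    (hc : ∀ y, B.edge (B.turnColor τ x.1) y ≠ y) {k : ℕ}
    (hk : k ≤ B.returnTime (B.turnColor τ x.1) x) :
    (B.faceWalk τ ^ (2 * k)) (x.1, 0) = ((B.faceStep (B.turnColor τ x.1) ^ k) x.1, 0) := by
  induction k with
  | zero => rfl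
  | succ k ih =>
    have h := faceWalk_pow_two_mul_add_one τ x hc hk (ih (Nat.le_of_succ_le hk))
    rw [show 2 * (k + 1) = (2 * k + 1) + 1 by ring, pow_succ', Equiv.Perm.mul_apply, h,
      faceWalk_apply, faceStep_pow_succ, B.white_edge (hc _),
      B.white_edge_zero_faceStep_pow hc x hk]
    unfold turnColor
    cases B.white x.1 <;> simp

/-- The faces of the pinched jacket through external legs are the faces of the boundary graph. -/
theorem card_legFaces (hB : ∀ (a : Fin n) x, B.edge a.succ x ≠ x) (τ : Equiv.Perm (Fin (n + 1)))
    {a b : Fin n} (ha : τ 0 = a.succ) (hb : τ⁻¹ 0 = b.succ) :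
    Nat.card {q : Quot (OrbitStep {B.faceWalk τ}) //
        ∃ y : B.Leg, Quot.mk _ ((y.1, 0) : X × Fin (n + 1)) = q} =
      Nat.card (Quot (OrbitStep {(B.boundary hB).edge a, (B.boundary hB).edge b})) := by
  -- White legs are left by color `a`, black legs by `b`. The ends of an open face are of opposite
  -- kinds, so an open face of either color at `x` is followed by the walk from `x` or from its
  -- other end.
  have hturn : ∀ x : B.Leg, ∃ c : Fin n, (c = a ∨ c = b) ∧ B.turnColor τ x.1 = c.succ ∧
      ∀ d : Fin n, d = a ∨ d = b → d = c ∨ B.turnColor τ (B.otherEnd d.succ x).1 = d.succ := by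
    intro x
    have hw := fun d : Fin n => B.white_otherEnd d.succ (hB d) x
    unfold turnColor
    cases hx : B.white x.1
    · refine ⟨b, Or.inr rfl, by simpa [hx] using hb, ?_⟩
      rintro d (rfl | rfl)
      · right; rw [hw, hx]; simpa using ha
      · exact Or.inl rfl
    · refine ⟨a, Or.inl rfl, by simpa [hx] using ha, ?_⟩
      rintro d (rfl | rfl)
      · exact Or.inl rfl
      · right; rw [hw, hx]; simpa using hb
  have hwalk : ∀ (x : B.Leg) (c : Fin n), B.turnColor τ x.1 = c.succ →
      (B.faceWalk τ ^ (2 * B.returnTime c.succ x)) (x.1, 0) = ((B.otherEnd c.succ x).1, 0) := by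
    intro x c hc
    have := faceWalk_pow_two_mul τ x (by rw [hc]; exact hB c) (le_refl _)
    rwa [hc] at this
  refine OrbitStep.card_quot_firstReturn (B.faceWalk τ)
    (fun x y h => Subtype.ext (congrArg Prod.fst h)) ?_ ?_
  · rintro x y ⟨s, hs, rfl⟩
    have key : ∃ d, (d = a ∨ d = b) ∧ s = (B.boundary hB).edge d := by
      rcases hs with rfl | rfl
      exacts [⟨a, Or.inl rfl, rfl⟩, ⟨b, Or.inr rfl, rfl⟩]
    obtain ⟨d, hd, rfl⟩ := key
    change _ = Quot.mk _ ((B.otherEnd d.succ x).1, (0 : Fin (n + 1)))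
    obtain ⟨c, -, hc, h⟩ := hturn x
    rcases h d hd with rfl | h
    · rw [← hwalk x d hc, OrbitStep.mk_singleton_pow]
    · have := hwalk _ d h
      rw [B.otherEnd_otherEnd] at this
      rw [← this, OrbitStep.mk_singleton_pow]
  · intro x
    obtain ⟨c, hcab, hc, -⟩ := hturn x
    refine ⟨B.otherEnd c.succ x, 2 * B.returnTime c.succ x,
      Nat.mul_pos two_pos (B.returnTime_pos _ _), hwalk x c hc, ?_, ?_⟩
    · exact ((B.boundary hB).mk_edge_pair a b hcab x).symm
    -- No earlier return: at even times the walk is not at a leg, and at odd times its color is not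
    -- 0.
    · rintro j hj0 hj ⟨y, hy⟩
      have hc' : ∀ y, B.edge (B.turnColor τ x.1) y ≠ y := by rw [hc]; exact hB c
      rcases Nat.even_or_odd' j with ⟨k, rfl | rfl⟩
      · rw [faceWalk_pow_two_mul τ x hc' (by rw [hc]; omega), hc] at hy
        refine B.edge_zero_ne_of_lt_returnTime (c := c.succ) (x := x) (k := k) (by omega)
          (by omega) ?_
        have hy₁ : y.1 = (B.faceStep c.succ ^ k) x.1 := congrArg Prod.fst hy
        rw [← hy₁]
        exact y.2
      · rw [faceWalk_pow_two_mul_add_one τ x hc' (by rw [hc]; omega)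
          (faceWalk_pow_two_mul τ x hc' (by rw [hc]; omega)), hc] at hy
        exact Fin.succ_ne_zero c (Prod.ext_iff.1 hy).2.symm

theorem numPinchedFaces_jacket (hB : ∀ (a : Fin n) x, B.edge a.succ x ≠ x)
    (τ : Equiv.Perm (Fin (n + 1))) {a b : Fin n} (ha : τ 0 = a.succ) (hb : τ⁻¹ 0 = b.succ) :
    (B.jacket τ).numPinchedFaces = ∑ k, B.numClosedFaces k (τ⁻¹ k) +
      Nat.card (Quot (OrbitStep {(B.boundary hB).edge a, (B.boundary hB).edge b})) := by
  classical
  rw [RibbonGraph.numPinchedFaces, OrbitStep.numOrbits_eq, ← B.card_internalFaces τ,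
    ← card_legFaces hB τ ha hb, ← Nat.card_sum]
  refine Nat.card_congr ((Equiv.sumCompl _).symm.trans
    (Equiv.sumCongr (Equiv.refl _) (Equiv.subtypeEquivRight fun q => ?_)))
  constructor
  · intro h
    push Not at h
    obtain ⟨⟨x, c⟩, hq, hx⟩ := h
    obtain rfl : c = 0 := by
      by_contra h0
      obtain ⟨d, rfl⟩ := Fin.exists_succ_eq.2 h0
      exact hB d x hx
    exact ⟨⟨x, hx⟩, hq⟩
  · rintro ⟨y, hq⟩ h
    exact h _ hq y.2

end Boundary

theorem numPinchedFaces_jacket_of_closed {n : ℕ} {X : Type*} [Finite X] {B : ColoredGraph n X}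
    (hB : ∀ c x, B.edge c x ≠ x) (τ : Equiv.Perm (Fin n)) :
    (B.jacket τ).numPinchedFaces = ∑ k, B.numClosedFaces k (τ⁻¹ k) := by
  rw [RibbonGraph.numPinchedFaces, OrbitStep.numOrbits_eq, ← B.card_internalFaces τ]
  exact Nat.card_congr (Equiv.subtypeUnivEquiv fun _ p _ => hB _ _).symm

theorem boundary_edge_ne {n : ℕ} {X : Type*} [Finite X] {B : ColoredGraph (n + 1) X}
    (hB : ∀ (a : Fin n) x, B.edge a.succ x ≠ x) (a : Fin n) (x : B.Leg) :
    (B.boundary hB).edge a x ≠ x := by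
  intro h
  have hw := B.white_otherEnd a.succ (hB a) x
  rw [show B.otherEnd a.succ x = x from h] at hw
  cases hx : B.white x.1 <;> simp [hx] at hw

end ColoredGraph

/-! ### Sums over the jackets -/

theorem sameCycle_of_mem_jacketCycles {n : ℕ} [NeZero n] {τ : Equiv.Perm (Fin n)}
    (hτ : τ ∈ jacketCycles n) (c d : Fin n) : τ.SameCycle c d := by
  have h : τ.cycleType = {n} := (Finset.mem_filter.1 hτ).2.1
  have hcyc : τ.IsCycle := Equiv.Perm.card_cycleType_eq_one.1 (by rw [h]; rfl)
  have hcard : τ.support = Finset.univ := by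
    rw [← Finset.card_eq_iff_eq_univ, ← Equiv.Perm.sum_cycleType, h]
    simp
  have hmem : ∀ c, τ c ≠ c := fun c => Equiv.Perm.mem_support.1 (by rw [hcard]; simp)
  exact hcyc.sameCycle (hmem c) (hmem d)

/-- As `N` is symmetric, only the number of occurrences of an unordered pair matters. Doubling the
sum removes the dependence on the orientation chosen for each cycle. -/
theorem Finset.two_mul_sum_of_symm {ι κ : Type*} [Fintype ι] [DecidableEq ι] (T : Finset κ)
    (u v : κ → ι) (N : ι → ι → ℕ) (hN : ∀ k l, N k l = N l k) (w : ι → ι → ℕ)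
    (hw : ∀ k l, (T.filter fun t => u t = k ∧ v t = l).card
      + (T.filter fun t => u t = l ∧ v t = k).card = w k l) :
    2 * ∑ t ∈ T, N (u t) (v t) = ∑ k, ∑ l, w k l * N k l := by
  have h : ∑ t ∈ T, N (u t) (v t)
      = ∑ k, ∑ l, (T.filter fun t => u t = k ∧ v t = l).card * N k l := by
    simp only [Finset.card_filter, Finset.sum_mul]
    simp only [Finset.sum_comm (s := Finset.univ) (t := T)]
    refine Finset.sum_congr rfl fun t _ => ?_
    simp [ite_and, Finset.sum_ite_eq]
  have h' : ∑ t ∈ T, N (u t) (v t)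
      = ∑ k, ∑ l, (T.filter fun t => u t = l ∧ v t = k).card * N k l := by
    rw [h, Finset.sum_comm]
    exact Finset.sum_congr rfl fun k _ => Finset.sum_congr rfl fun l _ => by rw [hN]
  rw [two_mul]
  nth_rw 1 [h]
  rw [h', ← Finset.sum_add_distrib]
  simp only [← Finset.sum_add_distrib, ← add_mul, hw]

/-- Each of the 12 cycles has 5 adjacent pairs among the 10 pairs of colors, so each pair occurs 6
times. -/
theorem two_mul_sum_jacketCycles_five (N : Fin 5 → Fin 5 → ℕ) (hN : ∀ k l, N k l = N l k) :
    2 * ∑ τ ∈ jacketCycles 5, ∑ k, N k (τ⁻¹ k) = 6 * ∑ k, ∑ l, if k = l then 0 else N k l := by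
  have := Finset.two_mul_sum_of_symm (jacketCycles 5 ×ˢ Finset.univ) (fun t => t.2)
    (fun t => t.1⁻¹ t.2) N hN (fun k l => if k = l then 0 else 6) (by decide +kernel)
  rw [Finset.sum_product] at this
  rw [this]
  simp [Finset.mul_sum]

/-- Each of the 3 cycles has 4 adjacent pairs among 6, so each pair occurs twice. -/
theorem two_mul_sum_jacketCycles_four (N : Fin 4 → Fin 4 → ℕ) (hN : ∀ k l, N k l = N l k) :
    2 * ∑ τ ∈ jacketCycles 4, ∑ k, N k (τ⁻¹ k) = 2 * ∑ k, ∑ l, if k = l then 0 else N k l := by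
  have := Finset.two_mul_sum_of_symm (jacketCycles 4 ×ˢ Finset.univ) (fun t => t.2)
    (fun t => t.1⁻¹ t.2) N hN (fun k l => if k = l then 0 else 2) (by decide +kernel)
  rw [Finset.sum_product] at this
  rw [this]
  simp [Finset.mul_sum]

/-- Each of the 6 pairs of nonzero colors surrounds 0 in 12 / 6 = 2 cycles. -/
theorem two_mul_sum_jacketCycles_zero (N : Fin 5 → Fin 5 → ℕ) (hN : ∀ k l, N k l = N l k) :
    2 * ∑ τ ∈ jacketCycles 5, N (τ 0) (τ⁻¹ 0) =
      2 * ∑ a : Fin 4, ∑ b : Fin 4, if a = b then 0 else N a.succ b.succ := by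
  have := Finset.two_mul_sum_of_symm (jacketCycles 5) (fun τ => τ 0) (fun τ => τ⁻¹ 0) N hN
    (fun k l => if k = 0 ∨ l = 0 ∨ k = l then 0 else 2) (by decide +kernel)
  rw [this]
  simp [Fin.sum_univ_succ]
  ring

/-! ### Orbits of two involutions -/

/-- The least element of the orbit of `x` under two involutions whose orbits have at most six
elements. -/
def leastInOrbit {α : Type*} [LinearOrder α] (σ ρ : Equiv.Perm α) (x : α) : α :=
  x ⊓ σ x ⊓ ρ x ⊓ ρ (σ x) ⊓ σ (ρ x) ⊓ σ (ρ (σ x))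

theorem mk_leastInOrbit {α : Type*} [LinearOrder α] {S : Set (Equiv.Perm α)} {σ ρ : Equiv.Perm α}
    (hσ : σ ∈ S) (hρ : ρ ∈ S) (x : α) :
    Quot.mk (OrbitStep S) (leastInOrbit σ ρ x) = Quot.mk _ x := by
  have hinf : ∀ {y z : α}, Quot.mk (OrbitStep S) y = Quot.mk _ x →
      Quot.mk (OrbitStep S) z = Quot.mk _ x → Quot.mk (OrbitStep S) (y ⊓ z) = Quot.mk _ x := by
    intro y z hy hz
    rcases min_choice y z with h | h
    exacts [by rw [h, hy], by rw [h, hz]]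
  unfold leastInOrbit
  refine hinf (hinf (hinf (hinf (hinf rfl ?_) ?_) ?_) ?_) ?_ <;>
    simp only [OrbitStep.mk_apply hσ, OrbitStep.mk_apply hρ]

/-- The hypotheses make `leastInOrbit` a complete invariant of orbits, so the count becomes
decidable for concrete involutions. -/
theorem card_quot_pair {α : Type*} [LinearOrder α] [Fintype α] (σ ρ : Equiv.Perm α)
    (hσ : ∀ x, leastInOrbit σ ρ (σ x) = leastInOrbit σ ρ x)
    (hρ : ∀ x, leastInOrbit σ ρ (ρ x) = leastInOrbit σ ρ x) :
    Nat.card (Quot (OrbitStep {σ, ρ})) = (Finset.univ.image (leastInOrbit σ ρ)).card := by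
  classical
  rw [← Fintype.card_coe, ← Nat.card_eq_fintype_card]
  refine Nat.card_congr (Equiv.ofBijective
    (Quot.lift (fun x => ⟨leastInOrbit σ ρ x, Finset.mem_image_of_mem _ (Finset.mem_univ x)⟩) ?_)
    ⟨?_, ?_⟩)
  · rintro x y ⟨s, rfl | rfl, rfl⟩
    exacts [Subtype.ext (hσ x).symm, Subtype.ext (hρ x).symm]
  · rintro ⟨x⟩ ⟨y⟩ h
    have h' : leastInOrbit σ ρ x = leastInOrbit σ ρ y := congrArg Subtype.val h
    have hx := mk_leastInOrbit (S := {σ, ρ}) (σ := σ) (ρ := ρ) (by simp) (by simp) x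
    rw [h', mk_leastInOrbit (by simp) (by simp)] at hx
    exact hx.symm
  · rintro ⟨y, hy⟩
    obtain ⟨x, -, rfl⟩ := Finset.mem_image.1 hy
    exact ⟨Quot.mk _ x, rfl⟩

/-! ### Faces inside the interaction vertices. -/

namespace InteractionKind

/-- The number of faces inside a vertex, each counted for both orders of its two colors. -/
noncomputable def numFacePairs (k : InteractionKind) : ℕ :=
  ∑ a, ∑ b, if a = b then 0 else Nat.card (Quot (OrbitStep {k.strand a, k.strand b}))

/-- The sum over all pairs of colors does not see the relabelling `π`, so one colored version of
each invariant suffices. -/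
theorem sum_pairs_eq {α : Type*} [LinearOrder α] [Fintype α] (p : Fin 4 → Equiv.Perm α)
    (hp : ∀ s t x, leastInOrbit (p s) (p t) (p s x) = leastInOrbit (p s) (p t) x ∧
      leastInOrbit (p s) (p t) (p t x) = leastInOrbit (p s) (p t) x) (π : Equiv.Perm (Fin 4)) :
    (∑ a, ∑ b, if a = b then 0 else
        Nat.card (Quot (OrbitStep {p (π.symm a), p (π.symm b)}))) =
      ∑ s, ∑ t, if s = t then 0 else (Finset.univ.image (leastInOrbit (p s) (p t))).card := by
  rw [← Equiv.sum_comp π]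
  refine Finset.sum_congr rfl fun s _ => ?_
  rw [← Equiv.sum_comp π]
  refine Finset.sum_congr rfl fun t _ => ?_
  simp only [π.symm_apply_apply, π.apply_eq_iff_eq]
  rw [card_quot_pair _ _ (fun x => (hp s t x).1) (fun x => (hp s t x).2)]

theorem numFacePairs_eq (k : InteractionKind) : k.numFacePairs =
    match k with
    | sextic1 _ => 24
    | sextic2 _ => 24
    | quartic _ => 18
    | mass => 12
    | wave => 12
    | anomalousHalf => 12 := by
  have htwo := (sum_pairs_eq (fun _ => (Equiv.swap 0 1 : Equiv.Perm (Fin 2)))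
    (by decide +kernel) 1).trans (show _ = 12 by decide +kernel)
  cases k with
  | sextic1 π =>
    exact (sum_pairs_eq sexticPattern1 (by decide +kernel) π).trans
      (show _ = 24 by decide +kernel)
  | sextic2 π =>
    exact (sum_pairs_eq sexticPattern2 (by decide +kernel) π).trans
      (show _ = 24 by decide +kernel)
  | quartic π =>
    exact (sum_pairs_eq quarticPattern (by decide +kernel) π).trans
      (show _ = 18 by decide +kernel)
  | mass => exact htwo
  | wave => exact htwo
  | anomalousHalf => exact htwo

/-- The trace invariants are connected. -/
theorem mk_strand_eq (k : InteractionKind) (i j : Fin k.arity) :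
    Quot.mk (OrbitStep (Set.range k.strand)) i = Quot.mk _ j := by
  -- In every pattern, colors 0 and 3 alone already connect all fields.
  have key : ∀ {m : ℕ} (p : Fin 4 → Equiv.Perm (Fin (m + 1))) (π : Equiv.Perm (Fin 4)),
      (∀ i, leastInOrbit (p 0) (p 3) i = 0) → ∀ i j : Fin (m + 1),
      Quot.mk (OrbitStep (Set.range fun a => p (π.symm a))) i = Quot.mk _ j := by
    intro m p π h i j
    have hmem : ∀ s, p s ∈ Set.range fun a => p (π.symm a) := fun s => ⟨π s, by simp⟩
    rw [← mk_leastInOrbit (hmem 0) (hmem 3) i, ← mk_leastInOrbit (hmem 0) (hmem 3) j, h, h]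
  have htwo := key (fun _ => (Equiv.swap 0 1 : Equiv.Perm (Fin 2))) 1 (by decide +kernel)
  cases k with
  | sextic1 π => exact key sexticPattern1 π (by decide +kernel) i j
  | sextic2 π => exact key sexticPattern2 π (by decide +kernel) i j
  | quartic π => exact key quarticPattern π (by decide +kernel) i j
  | mass => exact htwo i j
  | wave => exact htwo i j
  | anomalousHalf => exact htwo i j

theorem arity_pos (k : InteractionKind) : 0 < k.arity := by
  cases k <;> simp [arity]

end InteractionKind

/-! ### Vertices, lines, faces and components of the colored extension. -/

namespace FeynmanGraph

open InteractionKind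

variable {V : Type*} (G : FeynmanGraph V)

theorem card_halfLine [Fintype V] : Nat.card (HalfLine G.kind) = ∑ v, (G.kind v).arity := by
  rw [Nat.card_sigma]; simp

theorem card_vertexStrand_faces [Fintype V] (a b : Fin 4) :
    Nat.card (Quot (OrbitStep {G.vertexStrand a, G.vertexStrand b})) =
      ∑ v, Nat.card (Quot (OrbitStep {(G.kind v).strand a, (G.kind v).strand b})) := by
  refine Nat.card_quot_sigma _ _ ?_ ?_
  · rintro v i j ⟨s, rfl | rfl, rfl⟩
    exacts [⟨_, Or.inl rfl, rfl⟩, ⟨_, Or.inr rfl, rfl⟩]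
  · rintro ⟨v, i⟩ q ⟨s, rfl | rfl, rfl⟩
    exacts [⟨v, i, _, rfl, rfl, _, Or.inl rfl, rfl⟩, ⟨v, i, _, rfl, rfl, _, Or.inr rfl, rfl⟩]

/-- Vertex by vertex: 24 = 4·6, 18 = 4·4 + 2 and 12 = 4·2 + 4. -/
theorem sum_numFacePairs [Fintype V] : ∑ v, (G.kind v).numFacePairs =
    4 * Nat.card (HalfLine G.kind) + 2 * G.numQuartic
      + 4 * (G.numMass + G.numWave + G.numAnomalousHalf) := by
  classical
  unfold numQuartic numMass numWave numAnomalousHalf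
  have hcard : ∀ P : V → Prop, Nat.card {v // P v} = ∑ v, if P v then 1 else 0 := fun P => by
    rw [Nat.card_eq_fintype_card, Fintype.card_subtype, Finset.card_filter]
  simp only [card_halfLine, hcard, Finset.mul_sum, ← Finset.sum_add_distrib]
  refine Finset.sum_congr rfl fun v _ => ?_
  rw [numFacePairs_eq]
  cases G.kind v <;> simp [arity]

/-- Strands connect the fields of one vertex, lines of color 0 connect adjacent vertices. -/
theorem numComponents_coloredExtension (hG : G.Connected) :
    G.coloredExtension.numComponents = 1 := by
  rw [ColoredGraph.numComponents, OrbitStep.numOrbits_eq, Nat.card_eq_one_iff_unique]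
  set S : Set (Equiv.Perm (HalfLine G.kind)) := Set.range G.coloredExtension.edge with hS
  have hvertex : ∀ (v : V) (i j : Fin (G.kind v).arity),
      Quot.mk (OrbitStep S) ⟨v, i⟩ = Quot.mk (OrbitStep S) ⟨v, j⟩ := by
    intro v i j
    have hlift : ∀ i j, OrbitStep (Set.range (G.kind v).strand) i j →
        Quot.mk (OrbitStep S) ⟨v, i⟩ = Quot.mk (OrbitStep S) ⟨v, j⟩ := by
      rintro i - ⟨-, ⟨a, rfl⟩, rfl⟩
      exact Quot.sound ⟨G.coloredExtension.edge a.succ, ⟨_, rfl⟩, rfl⟩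
    exact congrArg (Quot.lift _ hlift) ((G.kind v).mk_strand_eq i j)
  have hline : ∀ h, Quot.mk (OrbitStep S) (G.line h) = Quot.mk (OrbitStep S) h := fun h =>
    OrbitStep.mk_apply (S := S) (s := G.line) (Set.mem_range_self (0 : Fin 5)) h
  have hadj : ∀ h : HalfLine G.kind, ∀ i j,
      Quot.mk (OrbitStep S) ⟨h.1, i⟩ = Quot.mk (OrbitStep S) ⟨(G.line h).1, j⟩ := fun h i j =>
    (hvertex _ i h.2).trans ((hline h).symm.trans (hvertex _ (G.line h).2 j))
  have hreach : ∀ v w : V, ∀ i j,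
      Quot.mk (OrbitStep S) ⟨v, i⟩ = Quot.mk (OrbitStep S) ⟨w, j⟩ := by
    intro v w
    obtain ⟨p⟩ := hG.preconnected v w
    induction p with
    | nil => exact hvertex _
    | cons hvw _ ih =>
      intro i j
      refine Eq.trans ?_ (ih ⟨0, arity_pos _⟩ j)
      rw [SimpleGraph.fromRel_adj] at hvw
      obtain ⟨-, ⟨h, rfl, rfl⟩ | ⟨h, rfl, rfl⟩⟩ := hvw
      exacts [hadj h _ _, (hadj h _ _).symm]
  obtain ⟨v⟩ := hG.nonempty
  exact ⟨⟨by rintro ⟨v, i⟩ ⟨w, j⟩; exact hreach v w i j⟩, ⟨Quot.mk _ ⟨v, 0, arity_pos _⟩⟩⟩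

theorem two_mul_numLines [Finite V] :
    2 * G.numLines = Nat.card {h : HalfLine G.kind // G.line h ≠ h} :=
  RibbonGraph.two_mul_numLines ⟨1, G.line, G.line_line⟩

theorem two_mul_numLines_add_numExternal [Finite V] :
    2 * G.numLines + G.numExternal = Nat.card (HalfLine G.kind) := by
  classical
  rw [two_mul_numLines, numExternal, add_comm, ← Nat.card_sum]
  exact Nat.card_congr (Equiv.sumCompl _)

/-- Legs have color 0 only, so the condition on color `a.succ` in `numClosedFaces` is automatic. -/
theorem numFaces_eq : G.numFaces = ∑ a : Fin 4, G.coloredExtension.numClosedFaces 0 a.succ := by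
  refine Finset.sum_congr rfl fun a _ => ?_
  unfold ColoredGraph.numClosedFaces
  rw [Set.pair_comm]
  refine (Nat.card_congr (Equiv.subtypeEquiv (OrbitStep.quotEquiv _) ?_)).symm
  rintro ⟨x⟩
  constructor
  · intro h y hy
    refine (h y (OrbitStep.mk_eq_mk_iff.2 ?_)).1
    exact hy
  · intro h y hy
    exact ⟨h y (OrbitStep.mk_eq_mk_iff.1 hy), G.coloredExtension_edge_succ_ne a y⟩

end FeynmanGraph

/-! ### The two genus sums. -/

namespace FeynmanGraph

open InteractionKind

variable {V : Type*} (G : FeynmanGraph V)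

theorem numClosedFaces_succ [Finite V] (a b : Fin 4) :
    G.coloredExtension.numClosedFaces a.succ b.succ =
      Nat.card (Quot (OrbitStep {G.vertexStrand a, G.vertexStrand b})) :=
  ColoredGraph.numClosedFaces_of_closed _ (G.coloredExtension_edge_succ_ne a)
    (G.coloredExtension_edge_succ_ne b)

theorem sum_numClosedFaces_succ [Fintype V] :
    (∑ a : Fin 4, ∑ b : Fin 4, if a = b then 0 else
        G.coloredExtension.numClosedFaces a.succ b.succ) = ∑ v, (G.kind v).numFacePairs := by
  simp only [numClosedFaces_succ, card_vertexStrand_faces, numFacePairs]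
  rw [Finset.sum_comm (s := (Finset.univ : Finset V))]
  refine Finset.sum_congr rfl fun a _ => ?_
  rw [Finset.sum_comm (s := (Finset.univ : Finset V))]
  refine Finset.sum_congr rfl fun b _ => ?_
  split_ifs <;> simp

/-- Pairs containing color 0 give the internal faces, once for each order; the other pairs give the
faces inside vertices. -/
theorem sum_numClosedFaces [Fintype V] :
    (∑ k, ∑ l, if k = l then 0 else G.coloredExtension.numClosedFaces k l) =
      2 * G.numFaces + ∑ v, (G.kind v).numFacePairs := by
  rw [← sum_numClosedFaces_succ, numFaces_eq, Fin.sum_univ_succ]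
  simp only [Fin.sum_univ_succ (n := 4), Fin.succ_inj, Fin.succ_ne_zero, (Fin.succ_ne_zero _).symm,
    if_true, if_false, Finset.sum_add_distrib, G.coloredExtension.numClosedFaces_comm _ 0]
  ring

theorem boundaryGraph_edge_ne [Finite V] (a : Fin 4) (x : G.coloredExtension.Leg) :
    G.boundaryGraph.edge a x ≠ x :=
  ColoredGraph.boundary_edge_ne G.coloredExtension_edge_succ_ne a x

/-- The number of faces of the boundary graph, as a function of the colors `a + 1` of the strands in
the colored extension. -/
noncomputable def numBoundaryFaces [Finite V] (k l : Fin 5) : ℕ :=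
  Fin.cases 0 (fun a => Fin.cases 0 (fun b => G.boundaryGraph.numClosedFaces a b) l) k

theorem numBoundaryFaces_comm [Finite V] (k l : Fin 5) :
    G.numBoundaryFaces k l = G.numBoundaryFaces l k := by
  refine Fin.cases ?_ (fun a => ?_) k <;> refine Fin.cases ?_ (fun b => ?_) l
  exacts [rfl, rfl, rfl, G.boundaryGraph.numClosedFaces_comm a b]

theorem numPinchedFaces_jacket [Finite V] {τ : Equiv.Perm (Fin 5)} (hτ : τ ∈ jacketCycles 5) :
    (G.coloredExtension.jacket τ).numPinchedFaces =
      ∑ k, G.coloredExtension.numClosedFaces k (τ⁻¹ k) + G.numBoundaryFaces (τ 0) (τ⁻¹ 0) := by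
  have hne : τ 0 ≠ 0 ∧ τ⁻¹ 0 ≠ 0 := by
    revert τ; decide +kernel
  obtain ⟨a, ha⟩ := Fin.exists_succ_eq.2 hne.1
  obtain ⟨b, hb⟩ := Fin.exists_succ_eq.2 hne.2
  rw [ColoredGraph.numPinchedFaces_jacket G.coloredExtension_edge_succ_ne τ ha.symm hb.symm,
    ← ha, ← hb]
  congr 1
  exact (ColoredGraph.numClosedFaces_of_closed _ (G.boundaryGraph_edge_ne a)
    (G.boundaryGraph_edge_ne b)).symm

/-- Each of the four strand colors matches all half-lines in pairs, which gives 4H / 2 lines besides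
those of color 0. -/
theorem numLines_jacket [Finite V] (τ : Equiv.Perm (Fin 5)) :
    (G.coloredExtension.jacket τ).numLines = G.numLines + 2 * Nat.card (HalfLine G.kind) := by
  have h := G.coloredExtension.two_mul_numLines_jacket τ
  rw [Fin.sum_univ_succ] at h
  have h0 : Nat.card {x // G.coloredExtension.edge 0 x ≠ x} = 2 * G.numLines :=
    G.two_mul_numLines.symm
  have hs : ∀ a : Fin 4, Nat.card {x // G.coloredExtension.edge a.succ x ≠ x} =
      Nat.card (HalfLine G.kind) := fun a =>
    Nat.card_congr (Equiv.subtypeUnivEquiv (G.coloredExtension_edge_succ_ne a))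
  simp only [h0, hs, Finset.sum_const, Finset.card_univ, Fintype.card_fin, smul_eq_mul] at h
  omega

theorem numLines_jacket_boundaryGraph [Finite V] (τ : Equiv.Perm (Fin 4)) :
    (G.boundaryGraph.jacket τ).numLines = 2 * G.numExternal := by
  have h := G.boundaryGraph.two_mul_numLines_jacket τ
  have hs : ∀ a : Fin 4, Nat.card {x // G.boundaryGraph.edge a x ≠ x} = G.numExternal := fun a =>
    Nat.card_congr (Equiv.subtypeUnivEquiv (G.boundaryGraph_edge_ne a))
  simp only [hs, Finset.sum_const, Finset.card_univ, Fintype.card_fin, smul_eq_mul] at h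
  omega

/-- The sum of the genera of the pinched jackets of the colored extension. -/
theorem sum_genus_jacket [Fintype V] (hG : G.Connected) :
    ∑ τ ∈ jacketCycles 5, (G.coloredExtension.jacket τ).genus =
      12 + 6 * (Nat.card (HalfLine G.kind) : ℚ) + 6 * G.numLines - 3 * G.numFaces
        - 3 / 2 * ((∑ v, (G.kind v).numFacePairs : ℕ) : ℚ)
        - 1 / 2 * ((∑ a, ∑ b, if a = b then 0 else G.boundaryGraph.numClosedFaces a b : ℕ) : ℚ) := by
  have h₁ := two_mul_sum_jacketCycles_five _ G.coloredExtension.numClosedFaces_comm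
  have h₂ := two_mul_sum_jacketCycles_zero _ G.numBoundaryFaces_comm
  rw [G.sum_numClosedFaces] at h₁
  -- With H vertices and L + 2H lines, 2 - V + (number of lines) is 2 + H + L.
  have h₃ : ∀ τ ∈ jacketCycles 5, (G.coloredExtension.jacket τ).genus =
      (2 + Nat.card (HalfLine G.kind) + G.numLines
        - ((∑ k, G.coloredExtension.numClosedFaces k (τ⁻¹ k) : ℕ) : ℚ)
        - (G.numBoundaryFaces (τ 0) (τ⁻¹ 0) : ℚ)) / 2 := by
    intro τ hτ
    rw [RibbonGraph.genus, RibbonGraph.eulerChar, G.numPinchedFaces_jacket hτ, G.numLines_jacket,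
      ColoredGraph.numVertices_jacket _ (sameCycle_of_mem_jacketCycles hτ),
      ColoredGraph.numComponents_jacket _ (sameCycle_of_mem_jacketCycles hτ),
      G.numComponents_coloredExtension hG]
    push_cast
    ring
  rw [Finset.sum_congr rfl h₃, ← Finset.sum_div, Finset.sum_sub_distrib, Finset.sum_sub_distrib,
    Finset.sum_const, card_jacketCycles_five, nsmul_eq_mul, ← Nat.cast_sum, ← Nat.cast_sum]
  have h₁' := congrArg (Nat.cast : ℕ → ℚ) h₁
  have h₂' := congrArg (Nat.cast : ℕ → ℚ) h₂
  rw [Nat.cast_mul, Nat.cast_mul, Nat.cast_add, Nat.cast_mul] at h₁'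
  rw [Nat.cast_mul, Nat.cast_mul] at h₂'
  -- On nonzero colors `numBoundaryFaces` unfolds to the count for the boundary graph.
  change _ = _ * ((∑ a, ∑ b, if a = b then 0 else G.boundaryGraph.numClosedFaces a b : ℕ) : ℚ)
    at h₂'
  norm_num only at h₁' h₂' ⊢
  linarith

/-- The sum of the genera of the jackets of the boundary graph. -/
theorem sum_genus_jacket_boundaryGraph [Finite V] :
    ∑ τ ∈ jacketCycles 4, (G.boundaryGraph.jacket τ).genus =
      3 * (G.boundaryGraph.numComponents : ℚ) + 3 / 2 * G.numExternal
        - 1 / 2 * ((∑ a, ∑ b, if a = b then 0 else G.boundaryGraph.numClosedFaces a b : ℕ) : ℚ) := by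
  have h₁ := two_mul_sum_jacketCycles_four _ G.boundaryGraph.numClosedFaces_comm
  have h₃ : ∀ τ ∈ jacketCycles 4, (G.boundaryGraph.jacket τ).genus =
      (2 * (G.boundaryGraph.numComponents : ℚ) + G.numExternal
        - ((∑ k, G.boundaryGraph.numClosedFaces k (τ⁻¹ k) : ℕ) : ℚ)) / 2 := by
    intro τ hτ
    rw [RibbonGraph.genus, RibbonGraph.eulerChar,
      ColoredGraph.numPinchedFaces_jacket_of_closed G.boundaryGraph_edge_ne,
      G.numLines_jacket_boundaryGraph,
      ColoredGraph.numVertices_jacket _ (sameCycle_of_mem_jacketCycles hτ),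
      ColoredGraph.numComponents_jacket _ (sameCycle_of_mem_jacketCycles hτ),
      show Nat.card G.coloredExtension.Leg = G.numExternal from rfl]
    push_cast
    ring
  rw [Finset.sum_congr rfl h₃, ← Finset.sum_div, Finset.sum_sub_distrib,
    Finset.sum_const, card_jacketCycles_four, nsmul_eq_mul, ← Nat.cast_sum]
  have h₁' := congrArg (Nat.cast : ℕ → ℚ) h₁
  rw [Nat.cast_mul, Nat.cast_mul] at h₁'
  norm_num only at h₁' ⊢
  linarith

end FeynmanGraph

theorem theorem2 {V : Type*} [Finite V] (G : FeynmanGraph V) (hG : G.Connected) :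
    (G.divergenceDegree : ℚ) =
      -(1 / 3) * (∑ J ∈ jacketCycles 5, (G.coloredExtension.jacket J).genus
          - ∑ J ∈ jacketCycles 4, (G.boundaryGraph.jacket J).genus)
        - ((G.boundaryGraph.numComponents : ℚ) - 1)
        - (G.numQuartic : ℚ)
        - 2 * ((G.numMass : ℚ) + (G.numAnomalousHalf : ℚ))
        - ((G.numExternal : ℚ) - 6) / 2 := by
  have := Fintype.ofFinite V
  -- In the difference the boundary faces cancel, and 6H cancels against 3/2 times the term 4H of
  -- `sum_numFacePairs`.
  rw [G.sum_genus_jacket hG, G.sum_genus_jacket_boundaryGraph, G.sum_numFacePairs,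
    ← G.two_mul_numLines_add_numExternal, FeynmanGraph.divergenceDegree]
  push_cast
  ring
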